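/- Let $G$ and $H$ be locally compact second countable (Hausdorff) groups. A metric on such a group is called \emph{admissible} if it induces the group topology, is left-invariant, and is proper, i.e. its closed balls are compact. A map $\phi\colon X\to Y$ between metric spaces is a \emph{coarse equivalence} if $\sup_{y\in Y}d(y,\phi[X])<\infty$ and, for all sequences $(x_n),(z_n)$ in $X$, $$\lim_n d(x_n,z_n)=\infty\iff \lim_n d(\phi(x_n),\phi(z_n))=\infty .$$ The groups $G$ and $H$ are \emph{coarsely equivalent} if there are admissible metrics $d_G$ on $G$ and $d_H$ on $H$ and a coarse equivalence $\phi\colon (G,d_G)\to (H,d_H)$. A \emph{topological coupling} of $G$ and $H$ is a pair $G\curvearrowright X\curvearrowleft H$ of commuting continuous actions (a left action of $G$ and a right action of $H$) on a non-empty locally compact Hausdorff space $X$ that are proper, i.e. for every compact $K\subseteq X$ the sets $\{g\in G\mid gK\cap K\neq\emptyset\}$ and $\{h\in H\mid Kh\cap K\neq\emptyset\}$ are compact, and cocompact, i.e. $X=G\cdot K=K\cdot H$ for some compact $K\subseteq X$. Then $G$ and $H$ are coarsely equivalent if and only if they admit a topological coupling. Moreover, for all admissible metrics $d_G$ on $G$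 and $d_H$ on $H$, there is a coarse equivalence $(G,d_G)\to(H,d_H)$ if and only if $G$ and $H$ admit a topological coupling. -/

import Mathlib

open Filter MulOpposite
open scoped Pointwise

/-- A coarse equivalence between two metric spaces: a map with cobounded image such that,
for all sequences of pairs, distances tend to infinity in the source if and only if they
tend to infinity in the target. -/
structure IsCoarseEquivalence {X Y : Type*} (mX : MetricSpace X) (mY : MetricSpace Y)
    (φ : X → Y) : Prop where
  cobounded : ∃ R : ℝ, ∀ y : Y, ∃ x : X, dist y (φ x) ≤ R
  tendsto_iff : ∀ x z : ℕ → X,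
    Tendsto (fun n => dist (x n) (z n)) atTop atTop ↔
      Tendsto (fun n => dist (φ (x n)) (φ (z n))) atTop atTop

/-- The metric `m` on the topological group `G` is compatible with the topology of `G`,
left-invariant, and proper (closed balls are compact). -/
structure IsCompatibleProperLeftInvariant {G : Type*} [Group G] [t : TopologicalSpace G]
    (m : MetricSpace G) : Prop where
  compatible : m.toUniformSpace.toTopologicalSpace = t
  left_invariant : ∀ g x y : G, m.dist (g * x) (g * y) = m.dist x y
  proper : ∀ (x : G) (r : ℝ), @IsCompact G t {y : G | m.dist y x ≤ r}

/-- Two topological groups are coarsely equivalent if there is a coarse equivalence between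
them for some compatible proper left-invariant metrics. -/
def CoarselyEquivalent (G H : Type*) [Group G] [TopologicalSpace G] [Group H]
    [TopologicalSpace H] : Prop :=
  ∃ (dG : MetricSpace G) (dH : MetricSpace H),
    IsCompatibleProperLeftInvariant dG ∧ IsCompatibleProperLeftInvariant dH ∧
      ∃ φ : G → H, IsCoarseEquivalence dG dH φ

/-- A left action of `G` and a right action of `H` (written, as usual, as an action of the
opposite group, `x · h = op h • x`) form a topological coupling on `X`. The space is required
to be non-empty, since otherwise all conditions hold trivially. -/
structure IsTopologicalCoupling (G H X : Type*) [Group G] [TopologicalSpace G] [Group H]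
    [TopologicalSpace H] [TopologicalSpace X] [MulAction G X] [MulAction Hᵐᵒᵖ X] : Prop where
  nonempty : Nonempty X
  t2Space : T2Space X
  locallyCompactSpace : LocallyCompactSpace X
  commute : ∀ (g : G) (h : H) (x : X), g • (op h • x) = op h • (g • x)
  continuous_left : Continuous fun p : G × X => p.1 • p.2
  continuous_right : Continuous fun p : X × H => op p.2 • p.1
  proper_left : ∀ K : Set X, IsCompact K → IsCompact {g : G | ((g • K) ∩ K).Nonempty}
  proper_right : ∀ K : Set X, IsCompact K → IsCompact {h : H | ((op h • K) ∩ K).Nonempty}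
  cocompact : ∃ K : Set X, IsCompact K ∧ (⋃ g : G, g • K) = Set.univ ∧
    (⋃ h : H, op h • K) = Set.univ

universe u v w

/-- `G` and `H` admit a topological coupling. The universe `w` is arbitrary, so the space may
live in any universe that is at least as large as those of `G` and `H`. -/
def AdmitTopologicalCoupling (G : Type u) (H : Type v) [Group G] [TopologicalSpace G]
    [Group H] [TopologicalSpace H] : Prop :=
  ∃ (X : Type (max u v w)) (_ : TopologicalSpace X) (_ : MulAction G X)
    (_ : MulAction Hᵐᵒᵖ X), IsTopologicalCoupling G H X

/-! Given a coupling, fix a point x₀ and a compact K whose translates under each group cover X, and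
choose φ(g) ∈ H with g⁻¹ x₀ φ(g) ∈ K. Then φ(x)⁻¹φ(z) and x⁻¹z carry the same pair of points of K to
one another, up to exchanging groups; properness of each action therefore bounds one element in
terms of the other (`IsTopologicalCoupling.exists_isCoarseEquivalence`).

Conversely, the distance to the graph of a coarse equivalence is a 1-Lipschitz function on G × H.
All functions satisfying the same quantitative estimates form a space X, invariant under translation
by both groups and closed under pointwise limits (`isClosed_setOf_isCoarseGraph`). Lipschitz bounds
and Tychonoff make {f | f(1,1) ≤ R} compact. The control ρ makes the actions proper, and the
constant R makes them cocompact (`CoarseGraph.isTopologicalCoupling`).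

Both constructions work for any prescribed admissible metrics. Struble's theorem only supplies such
metrics when a coupling alone is given. -/

/-! ### Existence of proper left-invariant metrics -/

open scoped Topology NNReal

/-- A two-sided filtration of a topological group by compact symmetric neighbourhoods of the
identity, in which the triple product of each member is contained in the next one. -/
structure IsCompactFiltration {G : Type*} [Group G] [TopologicalSpace G] (U : ℤ → Set G) :
    Prop where
  isCompact : ∀ n, IsCompact (U n)
  inv_eq : ∀ n, (U n)⁻¹ = U n
  mem_nhds : ∀ n, U n ∈ 𝓝 (1 : G)
  mul_mul_subset : ∀ n, U n * U n * U n ⊆ U (n + 1)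
  exists_mem : ∀ g, ∃ n, g ∈ U n
  exists_subset : ∀ V ∈ 𝓝 (1 : G), ∃ n, U n ⊆ V

theorem subset_mul_mul_self {G : Type*} [Group G] {S : Set G} (h : (1 : G) ∈ S) :
    S ⊆ S * S * S := fun x hx =>
  ⟨x * 1, ⟨x, hx, 1, h, rfl⟩, 1, h, by simp⟩

theorem exists_isCompactFiltration (G : Type*) [Group G] [TopologicalSpace G]
    [IsTopologicalGroup G] [LocallyCompactSpace G] [SecondCountableTopology G] :
    ∃ U : ℤ → Set G, IsCompactFiltration U := by
  let Good : Type _ := {S : Set G // IsCompact S ∧ S⁻¹ = S ∧ S ∈ 𝓝 (1 : G)}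
  have up : ∀ (S : Good) (K : Set G), IsCompact K →
      ∃ T : Good, S.1 * S.1 * S.1 ⊆ T.1 ∧ K ⊆ T.1 := by
    rintro ⟨S, hS, hSi, hS1⟩ K hK
    have hSS : IsCompact (S * S * S) := (hS.mul hS).mul hS
    refine ⟨⟨(S * S * S ∪ K) ∪ (S * S * S ∪ K)⁻¹, (hSS.union hK).union (hSS.union hK).inv, ?_, ?_⟩,
      ?_, ?_⟩
    · rw [Set.union_inv, inv_inv, Set.union_comm]
    · exact mem_of_superset hS1 fun x hx =>
        Or.inl (Or.inl (subset_mul_mul_self (mem_of_mem_nhds hS1) hx))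
    · exact fun x hx => Or.inl (Or.inl hx)
    · exact fun x hx => Or.inl (Or.inr hx)
  have down : ∀ (S : Good) (V : Set G), V ∈ 𝓝 (1 : G) →
      ∃ T : Good, T.1 * T.1 * T.1 ⊆ S.1 ∧ T.1 ⊆ V := by
    rintro ⟨S, hS, hSi, hS1⟩ V hV
    -- Halving twice suffices for a triple product: W * W * W ⊆ V' * V' ⊆ S ∩ V.
    obtain ⟨V', hV', -, -, hVV⟩ :=
      exists_closed_nhds_one_inv_eq_mul_subset (inter_mem hS1 hV)
    obtain ⟨W, hW, hWc, hWi, hWW⟩ := exists_closed_nhds_one_inv_eq_mul_subset hV'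
    have hWV : W ⊆ V' := fun x hx => hWW ⟨x, hx, 1, mem_of_mem_nhds hW, by simp⟩
    have h3 : W * W * W ⊆ S ∩ V := (Set.mul_subset_mul hWW hWV).trans hVV
    have h1 : W ⊆ S ∩ V := (subset_mul_mul_self (mem_of_mem_nhds hW)).trans h3
    exact ⟨⟨W, hS.of_isClosed_subset hWc (h1.trans Set.inter_subset_left), hWi, hW⟩,
      h3.trans Set.inter_subset_left, h1.trans Set.inter_subset_right⟩
  obtain ⟨C, hC, hC1⟩ := exists_compact_mem_nhds (1 : G)
  let C₀ : Good := ⟨C ∪ C⁻¹, hC.union hC.inv, by rw [Set.union_inv, inv_inv, Set.union_comm],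
    mem_of_superset hC1 Set.subset_union_left⟩
  obtain ⟨B, hB⟩ := (𝓝 (1 : G)).exists_antitone_basis
  choose u hu huK using fun (S : Good) (n : ℕ) =>
    up S (compactCovering G n) (isCompact_compactCovering G n)
  choose v hv hvB using fun (S : Good) (n : ℕ) => down S (B n) (hB.mem n)
  let P : ℕ → Good := fun n => Nat.rec C₀ (fun n S => u S n) n
  let N : ℕ → Good := fun n => Nat.rec C₀ (fun n S => v S n) n
  -- The two sequences share the term `C₀` at index 0, so the product inclusion also holds across
  -- the junction from -1 to 0.
  let U : ℤ → Good := fun z => match z with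
    | Int.ofNat n => P n
    | Int.negSucc n => N (n + 1)
  refine ⟨fun z => (U z).1, fun n => (U n).2.1, fun n => (U n).2.2.1, fun n => (U n).2.2.2,
    fun n => ?_, fun g => ?_, fun V hV => ?_⟩
  · match n with
    | Int.ofNat n => exact hu (P n) n
    | Int.negSucc 0 => exact hv (N 0) 0
    | Int.negSucc (n + 1) => exact hv (N (n + 1)) (n + 1)
  · obtain ⟨n, hn⟩ := exists_mem_compactCovering g
    exact ⟨Int.ofNat (n + 1), huK (P n) n hn⟩
  · obtain ⟨n, -, hn⟩ := hB.1.mem_iff.1 hV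
    exact ⟨Int.negSucc n, (hvB (N n) n).trans hn⟩

namespace IsCompactFiltration

variable {G : Type*} [Group G] [TopologicalSpace G] {U : ℤ → Set G}

theorem one_mem (hU : IsCompactFiltration U) (n : ℤ) : (1 : G) ∈ U n :=
  mem_of_mem_nhds (hU.mem_nhds n)

theorem monotone (hU : IsCompactFiltration U) : Monotone U :=
  monotone_int_of_le_succ fun n =>
    (subset_mul_mul_self (hU.one_mem n)).trans (hU.mul_mul_subset n)

end IsCompactFiltration

/-- The infimum of the numbers `2 ^ n` over all `n` with `g ∈ U n`. -/
noncomputable def filtrationLength {G : Type*} (U : ℤ → Set G) (g : G) : ℝ≥0 :=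
  ⨅ n : {n : ℤ // g ∈ U n}, (2 : ℝ≥0) ^ (n : ℤ)

theorem filtrationLength_le {G : Type*} {U : ℤ → Set G} {g : G} {n : ℤ} (h : g ∈ U n) :
    filtrationLength U g ≤ 2 ^ n :=
  ciInf_le (OrderBot.bddBelow _) (⟨n, h⟩ : {n : ℤ // g ∈ U n})

namespace IsCompactFiltration

variable {G : Type*} [Group G] [TopologicalSpace G] {U : ℤ → Set G}

/-- Values between consecutive powers of 2 do not matter: some 2 ^ m < 2 ^ (n + 1) is attained,
which forces m ≤ n. -/
theorem mem_of_filtrationLength_lt (hU : IsCompactFiltration U) {g : G} {n : ℤ}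
    (h : filtrationLength U g < 2 ^ (n + 1)) : g ∈ U n := by
  have : Nonempty {n : ℤ // g ∈ U n} := nonempty_subtype.2 (hU.exists_mem g)
  obtain ⟨⟨m, hm⟩, hlt⟩ := exists_lt_of_ciInf_lt h
  have : m < n + 1 := (zpow_lt_zpow_iff_right₀ (one_lt_two : (1 : ℝ≥0) < 2)).1 hlt
  exact hU.monotone (Int.lt_add_one_iff.1 this) hm

theorem filtrationLength_one (hU : IsCompactFiltration U) :
    filtrationLength U (1 : G) = 0 := by
  refine le_antisymm (le_of_forall_pos_le_add fun ε hε => ?_) zero_le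
  obtain ⟨n, hn, -⟩ := exists_mem_Ico_zpow (y := (2 : ℝ≥0)) hε one_lt_two
  simpa using (filtrationLength_le (hU.one_mem n)).trans hn

theorem filtrationLength_inv (hU : IsCompactFiltration U) (g : G) :
    filtrationLength U g⁻¹ = filtrationLength U g := by
  have : ∀ n, g⁻¹ ∈ U n ↔ g ∈ U n := fun n => by rw [← Set.mem_inv, hU.inv_eq]
  exact (Equiv.subtypeEquivRight this).iInf_congr fun _ => rfl

/-- A triple product costs one step of the filtration, hence a factor 2. This is the weak triangle
inequality needed for metrization by chains. -/
theorem filtrationLength_mul_mul (hU : IsCompactFiltration U) (a b c : G) :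
    filtrationLength U (a * b * c) ≤
      2 * max (filtrationLength U a) (max (filtrationLength U b) (filtrationLength U c)) := by
  set M := max (filtrationLength U a) (max (filtrationLength U b) (filtrationLength U c)) with hM
  have key : ∀ t, M < t → filtrationLength U (a * b * c) ≤ 2 * t := by
    intro t ht
    obtain ⟨n, hn, hn'⟩ := exists_mem_Ico_zpow (y := (2 : ℝ≥0)) (zero_le.trans_lt ht) one_lt_two
    have hlt : M < 2 ^ (n + 1) := ht.trans hn'
    have ha := hU.mem_of_filtrationLength_lt ((le_max_left _ _).trans_lt hlt)
    have hb := hU.mem_of_filtrationLength_lt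
      (((le_max_left _ _).trans (le_max_right _ _)).trans_lt hlt)
    have hc := hU.mem_of_filtrationLength_lt
      (((le_max_right _ _).trans (le_max_right _ _)).trans_lt hlt)
    refine (filtrationLength_le (hU.mul_mul_subset n
      (Set.mul_mem_mul (Set.mul_mem_mul ha hb) hc))).trans ?_
    rw [zpow_add_one₀ two_ne_zero, mul_comm]
    gcongr
  refine le_of_forall_pos_le_add fun ε hε => ?_
  refine (key (M + ε / 2) (lt_add_of_pos_right _ (half_pos hε))).trans_eq ?_
  rw [mul_add, mul_div_cancel₀ _ two_ne_zero]

/-- Infima of sums of lengths along chains give a pseudometric within a factor 2 of the length.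
Small balls are thus comparable to the U n with n → -∞, giving the topology, and large balls lie in
translates of U n, giving properness. -/
theorem exists_metricSpace (hU : IsCompactFiltration U) [IsTopologicalGroup G] [T2Space G] :
    ∃ m : MetricSpace G, IsCompatibleProperLeftInvariant m := by
  let d : G → G → ℝ≥0 := fun x y => filtrationLength U (x⁻¹ * y)
  have d_self : ∀ x, d x x = 0 := fun x => by simp [d, hU.filtrationLength_one]
  have d_comm : ∀ x y, d x y = d y x := fun x y => by
    simp only [d]; rw [← hU.filtrationLength_inv]; simp
  let p : PseudoMetricSpace G := PseudoMetricSpace.ofPreNNDist d d_self d_comm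
  have le_d : ∀ x y : G, dist x y ≤ d x y := PseudoMetricSpace.dist_ofPreNNDist_le d d_self d_comm
  have d_le : ∀ x y : G, (d x y : ℝ) ≤ 2 * dist x y := by
    refine PseudoMetricSpace.le_two_mul_dist_ofPreNNDist d d_self d_comm fun a b c e => ?_
    have := hU.filtrationLength_mul_mul (a⁻¹ * b) (b⁻¹ * c) (c⁻¹ * e)
    simpa [d, mul_assoc] using this
  have left_inv : ∀ g x y : G, dist (g * x) (g * y) = dist x y := by
    intro g x y
    refine (PseudoMetricSpace.dist_ofPreNNDist d d_self d_comm _ _).trans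
      (Eq.trans ?_ (PseudoMetricSpace.dist_ofPreNNDist d d_self d_comm _ _).symm)
    congr 1
    -- Left translation by g permutes the chains of intermediate points and preserves their sums.
    refine (((Equiv.mulLeft g).listEquivOfEquiv).iInf_congr fun l => ?_).symm
    have hd : ∀ a b, d (g * a) (g * b) = d a b := fun a b => by simp [d, mul_assoc]
    change (List.zipWith d ((g * x) :: l.map (g * ·)) (l.map (g * ·) ++ [g * y])).sum = _
    rw [show (g * x) :: l.map (g * ·) = (x :: l).map (g * ·) from rfl,
      show l.map (g * ·) ++ [g * y] = (l ++ [y]).map (g * ·) by simp, List.zipWith_map]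
    simp only [hd]
  have mem_of_dist : ∀ (x y : G) (n : ℤ), dist x y < 2 ^ n → x⁻¹ * y ∈ U n := by
    intro x y n h
    refine hU.mem_of_filtrationLength_lt (NNReal.coe_lt_coe.1 ((d_le x y).trans_lt ?_))
    push_cast
    rw [zpow_add_one₀ two_ne_zero]
    linarith
  have dist_le_of_mem : ∀ (x y : G) (n : ℤ), x⁻¹ * y ∈ U n → dist x y ≤ 2 ^ n := by
    intro x y n h
    exact (le_d x y).trans (by exact_mod_cast filtrationLength_le h)
  have eq_of_dist : ∀ {x y : G}, dist x y = 0 → x = y := by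
    intro x y h
    by_contra hne
    have hne' : x⁻¹ * y ≠ 1 := fun h' => hne (inv_mul_eq_one.1 h')
    obtain ⟨n, hn⟩ := hU.exists_subset {x⁻¹ * y}ᶜ (isOpen_compl_singleton.mem_nhds hne'.symm)
    exact hn (mem_of_dist x y n (h ▸ by positivity)) rfl
  let m : MetricSpace G := { p with eq_of_dist_eq_zero := eq_of_dist }
  have compat : m.toUniformSpace.toTopologicalSpace = ‹TopologicalSpace G› := by
    refine TopologicalSpace.ext_nhds fun x => ?_
    rw [← map_mul_left_nhds_one x]
    ext s
    rw [(@Metric.nhds_basis_ball G p x).mem_iff, mem_map]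
    constructor
    · rintro ⟨ε, hε, hs⟩
      obtain ⟨n, hn, -⟩ := exists_mem_Ioc_zpow hε (one_lt_two : (1 : ℝ) < 2)
      refine mem_of_superset (hU.mem_nhds n) fun y hy => hs ?_
      rw [Metric.mem_ball, dist_comm]
      exact (dist_le_of_mem x (x * y) n (by simpa using hy)).trans_lt hn
    · intro hs
      obtain ⟨n, hn⟩ := hU.exists_subset _ hs
      refine ⟨2 ^ n, by positivity, fun y hy => ?_⟩
      have := hn (mem_of_dist x y n (by rw [dist_comm]; exact hy))
      simpa using this
  refine ⟨m, compat, left_inv, fun x r => ?_⟩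
  obtain ⟨n, hn⟩ := pow_unbounded_of_one_lt r (one_lt_two : (1 : ℝ) < 2)
  have hsub : {y : G | m.dist y x ≤ r} ⊆ x • U n := by
    intro y hy
    rw [Set.mem_smul_set_iff_inv_smul_mem]
    refine mem_of_dist x y n ?_
    rw [dist_comm, zpow_natCast]
    exact lt_of_le_of_lt hy hn
  refine ((hU.isCompact n).smul x).of_isClosed_subset ?_ hsub
  rw [← compat]
  exact @Metric.isClosed_closedBall G p x r

end IsCompactFiltration

/-- **Struble's theorem**. -/
theorem exists_isCompatibleProperLeftInvariant (G : Type*) [Group G] [TopologicalSpace G]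
    [IsTopologicalGroup G] [T2Space G] [LocallyCompactSpace G] [SecondCountableTopology G] :
    ∃ m : MetricSpace G, IsCompatibleProperLeftInvariant m :=
  let ⟨_, hU⟩ := exists_isCompactFiltration G
  hU.exists_metricSpace

/-! ### Uniform control of coarse equivalences -/

/-- Without a uniform bound one could pick points with a ≤ r and b > n for each n, contradicting the
sequential hypothesis. -/
theorem forall_exists_bound_of_tendsto {α : Type*} {a b : α → ℝ}
    (h : ∀ x : ℕ → α, Tendsto (fun n => b (x n)) atTop atTop →
      Tendsto (fun n => a (x n)) atTop atTop) (r : ℝ) :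
    ∃ C, ∀ p, a p ≤ r → b p ≤ C := by
  by_contra! hcon
  choose x hxa hxb using fun n : ℕ => hcon n
  have hb := h x (tendsto_atTop_mono (fun n => (hxb n).le) tendsto_natCast_atTop_atTop)
  obtain ⟨n, hn⟩ := (hb.eventually (eventually_gt_atTop r)).exists
  exact absurd (hxa n) (not_le.2 hn)

theorem tendsto_of_forall_exists_bound {a b : ℕ → ℝ} (h : ∀ r, ∃ C, ∀ n, b n ≤ r → a n ≤ C)
    (ha : Tendsto a atTop atTop) : Tendsto b atTop atTop := by
  refine tendsto_atTop.2 fun r => ?_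
  obtain ⟨C, hC⟩ := h r
  filter_upwards [ha.eventually (eventually_gt_atTop C)] with n hn
  by_contra hlt
  exact absurd (hC n (not_le.1 hlt).le) (not_le.2 hn)

namespace IsCoarseEquivalence

variable {X Y : Type*} [mX : MetricSpace X] [mY : MetricSpace Y] {φ : X → Y}

theorem exists_dist_map_le (hφ : IsCoarseEquivalence mX mY φ) (r : ℝ) :
    ∃ C, ∀ x z, dist x z ≤ r → dist (φ x) (φ z) ≤ C := by
  obtain ⟨C, hC⟩ := forall_exists_bound_of_tendsto (α := X × X)
    (a := fun p => dist p.1 p.2) (b := fun p => dist (φ p.1) (φ p.2))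
    (fun x => (hφ.tendsto_iff (fun n => (x n).1) (fun n => (x n).2)).2) r
  exact ⟨C, fun x z => hC (x, z)⟩

theorem exists_dist_le (hφ : IsCoarseEquivalence mX mY φ) (r : ℝ) :
    ∃ C, ∀ x z, dist (φ x) (φ z) ≤ r → dist x z ≤ C := by
  obtain ⟨C, hC⟩ := forall_exists_bound_of_tendsto (α := X × X)
    (b := fun p => dist p.1 p.2) (a := fun p => dist (φ p.1) (φ p.2))
    (fun x => (hφ.tendsto_iff (fun n => (x n).1) (fun n => (x n).2)).1) r
  exact ⟨C, fun x z => hC (x, z)⟩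

theorem of_bounds (hco : ∃ R : ℝ, ∀ y : Y, ∃ x : X, dist y (φ x) ≤ R)
    (h₁ : ∀ r, ∃ C, ∀ x z, dist x z ≤ r → dist (φ x) (φ z) ≤ C)
    (h₂ : ∀ r, ∃ C, ∀ x z, dist (φ x) (φ z) ≤ r → dist x z ≤ C) :
    IsCoarseEquivalence mX mY φ where
  cobounded := hco
  tendsto_iff x z :=
    ⟨tendsto_of_forall_exists_bound fun r => (h₂ r).imp fun _ hC n => hC (x n) (z n),
      tendsto_of_forall_exists_bound fun r => (h₁ r).imp fun _ hC n => hC (x n) (z n)⟩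

end IsCoarseEquivalence

/-! ### From couplings to coarse equivalences -/

/-- The set of elements moving some point of a compact set into another compact set is contained
in a compact set. -/
theorem IsTopologicalCoupling.exists_isCompact_left {G H X : Type*} [Group G]
    [TopologicalSpace G] [Group H] [TopologicalSpace H] [TopologicalSpace X] [MulAction G X]
    [MulAction Hᵐᵒᵖ X] (hX : IsTopologicalCoupling G H X) {A B : Set X} (hA : IsCompact A)
    (hB : IsCompact B) : ∃ C : Set G, IsCompact C ∧ ∀ g, ∀ a ∈ A, g • a ∈ B → g ∈ C :=
  ⟨_, hX.proper_left _ (hA.union hB), fun g a ha hgB =>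
    ⟨g • a, Set.smul_mem_smul_set (Or.inl ha), Or.inr hgB⟩⟩

theorem IsTopologicalCoupling.exists_isCompact_right {G H X : Type*} [Group G]
    [TopologicalSpace G] [Group H] [TopologicalSpace H] [TopologicalSpace X] [MulAction G X]
    [MulAction Hᵐᵒᵖ X] (hX : IsTopologicalCoupling G H X) {A B : Set X} (hA : IsCompact A)
    (hB : IsCompact B) : ∃ C : Set H, IsCompact C ∧ ∀ h, ∀ a ∈ A, op h • a ∈ B → h ∈ C :=
  ⟨_, hX.proper_right _ (hA.union hB), fun h a ha hgB =>
    ⟨op h • a, Set.smul_mem_smul_set (Or.inl ha), Or.inr hgB⟩⟩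

theorem dist_eq_dist_inv_mul_one {G : Type*} [Group G] [MetricSpace G] [IsIsometricSMul G G]
    (x z : G) : dist x z = dist (x⁻¹ * z) 1 := by
  rw [← dist_mul_left x⁻¹ x z, inv_mul_cancel, dist_comm]

theorem IsTopologicalCoupling.exists_isCoarseEquivalence {G H X : Type*} [Group G]
    [mG : MetricSpace G] [ProperSpace G] [IsIsometricSMul G G]
    [Group H] [mH : MetricSpace H] [ProperSpace H] [IsIsometricSMul H H]
    [TopologicalSpace X] [MulAction G X] [MulAction Hᵐᵒᵖ X]
    (hX : IsTopologicalCoupling G H X) : ∃ φ : G → H, IsCoarseEquivalence mG mH φ := by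
  obtain ⟨K, hK, hGK, hHK⟩ := hX.cocompact
  obtain ⟨x₀⟩ := hX.nonempty
  have hφ : ∀ g : G, ∃ h : H, op h • g⁻¹ • x₀ ∈ K := fun g => by
    obtain ⟨h, hh⟩ := Set.mem_iUnion.1 (hHK.symm ▸ Set.mem_univ (g⁻¹ • x₀))
    exact ⟨h⁻¹, Set.mem_smul_set_iff_inv_smul_mem.1 hh⟩
  choose φ hφ using hφ
  -- the two cocycles move points of `K` in the same way
  have key : ∀ (g g' : G) (h h' : H), op (h'⁻¹ * h) • op h' • g'⁻¹ • x₀ =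
      (g'⁻¹ * g) • op h • g⁻¹ • x₀ := by
    intro g g' h h'
    rw [hX.commute, smul_smul, smul_smul (g'⁻¹ * g)]
    simp [← op_mul]
  refine ⟨φ, IsCoarseEquivalence.of_bounds ?_ (fun r => ?_) fun r => ?_⟩
  · obtain ⟨C, hC, hCK⟩ := hX.exists_isCompact_right hK hK
    obtain ⟨r, hr⟩ := hC.isBounded.subset_closedBall 1
    refine ⟨r, fun h => ?_⟩
    obtain ⟨g, hg⟩ := Set.mem_iUnion.1 (hGK.symm ▸ Set.mem_univ (op h • x₀))
    rw [Set.mem_smul_set_iff_inv_smul_mem, hX.commute] at hg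
    refine ⟨g, ?_⟩
    rw [dist_comm, dist_eq_dist_inv_mul_one]
    refine hr (hCK _ _ (hφ g) ?_)
    rwa [key g g, inv_mul_cancel, one_smul]
  -- By `key`, φ(x)⁻¹φ(z) sends a point of K into the compact set obtained by moving K with the
  -- r-ball of G; the last case exchanges the groups.
  · have hB : IsCompact ((fun p : G × X => p.1 • p.2) '' (Metric.closedBall 1 r ×ˢ K)) :=
      ((isCompact_closedBall 1 r).prod hK).image hX.continuous_left
    obtain ⟨C, hC, hCK⟩ := hX.exists_isCompact_right hK hB
    obtain ⟨ρ, hρ⟩ := hC.isBounded.subset_closedBall 1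
    refine ⟨ρ, fun x z hxz => ?_⟩
    rw [dist_eq_dist_inv_mul_one] at hxz ⊢
    refine hρ (hCK _ _ (hφ x) ?_)
    rw [key z x]
    exact ⟨(x⁻¹ * z, op (φ z) • z⁻¹ • x₀), ⟨hxz, hφ z⟩, rfl⟩
  · have hB : IsCompact ((fun p : X × H => op p.2 • p.1) '' (K ×ˢ Metric.closedBall 1 r)) :=
      (hK.prod (isCompact_closedBall 1 r)).image hX.continuous_right
    obtain ⟨C, hC, hCK⟩ := hX.exists_isCompact_left hK hB
    obtain ⟨ρ, hρ⟩ := hC.isBounded.subset_closedBall 1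
    refine ⟨ρ, fun x z hxz => ?_⟩
    rw [dist_eq_dist_inv_mul_one] at hxz ⊢
    refine hρ (hCK _ _ (hφ z) ?_)
    rw [← key z x]
    exact ⟨(op (φ x) • x⁻¹ • x₀, (φ x)⁻¹ * φ z), ⟨hφ x, hxz⟩, rfl⟩

/-! ### From coarse equivalences to couplings -/

/-- A function on `G × H` behaving like the distance to the graph of a coarse equivalence, with
control function `ρ` and coboundedness constant `R`. -/
structure IsCoarseGraph {G H : Type*} [MetricSpace G] [MetricSpace H] (ρ : ℝ → ℝ) (R : ℝ)
    (f : G × H → ℝ) : Prop where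
  nonneg : ∀ p, 0 ≤ f p
  le_add_dist : ∀ x x' y y', f (x, y) ≤ f (x', y') + dist x x' + dist y y'
  dist_fst_le : ∀ s x x' y, f (x, y) < s → f (x', y) < s → dist x x' ≤ ρ s
  dist_snd_le : ∀ s x y y', f (x, y) < s → f (x, y') < s → dist y y' ≤ ρ s
  exists_fst : ∀ y, ∃ x, f (x, y) ≤ R
  exists_snd : ∀ x, ∃ y, f (x, y) ≤ R

/-- A limit of `1`-Lipschitz functions which are at most `R` at points staying in a bounded set is
at most `R` at some point. -/
theorem exists_le_of_tendsto_ultrafilter {α Y : Type*} [MetricSpace Y] [ProperSpace Y]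
    (u : Ultrafilter α) {F : α → Y → ℝ} {f : Y → ℝ} {R C : ℝ} (y₀ : Y)
    (hF : ∀ y, Tendsto (fun a => F a y) u (𝓝 (f y)))
    (hlip : ∀ᶠ a in u, ∀ y y', F a y ≤ F a y' + dist y y')
    (hex : ∀ᶠ a in u, ∃ y, dist y y₀ ≤ C ∧ F a y ≤ R) : ∃ y, f y ≤ R := by
  obtain ⟨Y', hY'⟩ := hex.choice
  obtain ⟨y, -, hy⟩ := (isCompact_closedBall y₀ C).ultrafilter_le_nhds (u.map Y')
    (le_principal_iff.2 (hY'.mono fun a ha => ha.1))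
  refine ⟨y, le_of_tendsto_of_tendsto (hF y)
    (b := (u : Filter α)) (g := fun a => R + dist y (Y' a)) ?_ ?_⟩
  · have : Tendsto Y' u (𝓝 y) := hy
    simpa using (tendsto_const_nhds (x := R)).add ((tendsto_const_nhds (x := y)).dist this)
  · filter_upwards [hlip, hY'] with a ha ha'
    exact (ha y (Y' a)).trans (by linarith [ha'.2])

/-- The strict sublevel conditions pass from the limit to nearby functions, so the control estimates
survive. The existence conditions survive because the same estimates keep the witnesses in a
bounded, hence relatively compact, set. -/
theorem isClosed_setOf_isCoarseGraph {G H : Type*} [MetricSpace G] [ProperSpace G]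
    [MetricSpace H] [ProperSpace H] (ρ : ℝ → ℝ) (R : ℝ) :
    IsClosed {f : G × H → ℝ | IsCoarseGraph ρ R f} := by
  rw [isClosed_iff_ultrafilter]
  intro f u hu hS
  have hlim : ∀ p, Tendsto (fun F : G × H → ℝ => F p) u (𝓝 (f p)) := fun p =>
    ((continuous_apply p).tendsto f).mono_left hu
  have hS' : ∀ᶠ F in (u : Filter (G × H → ℝ)), IsCoarseGraph ρ R F := hS
  refine ⟨fun p => ?_, fun x x' y y' => ?_, fun s x x' y h h' => ?_, fun s x y y' h h' => ?_,
    fun y => ?_, fun x => ?_⟩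
  · exact ge_of_tendsto (hlim p) (hS'.mono fun F hF => hF.nonneg p)
  · exact le_of_tendsto_of_tendsto (hlim _) (((hlim (x', y')).add_const _).add_const _)
      (hS'.mono fun F hF => hF.le_add_dist x x' y y')
  · obtain ⟨F, hF, h₁, h₂⟩ := (hS'.and (((hlim _).eventually (eventually_lt_nhds h)).and
      ((hlim _).eventually (eventually_lt_nhds h')))).exists
    exact hF.dist_fst_le s x x' y h₁ h₂
  · obtain ⟨F, hF, h₁, h₂⟩ := (hS'.and (((hlim _).eventually (eventually_lt_nhds h)).and
      ((hlim _).eventually (eventually_lt_nhds h')))).exists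
    exact hF.dist_snd_le s x y y' h₁ h₂
  · rcases isEmpty_or_nonempty G with _ | ⟨⟨x₀⟩⟩
    · obtain ⟨F, hF⟩ := hS'.exists
      exact isEmptyElim (hF.exists_fst y).choose
    -- This level lies strictly above both f (x₀, y) and R, so x₀ and the witnesses share a sublevel
    -- set, whose diameter ρ bounds.
    have hs : f (x₀, y) < max (f (x₀, y)) R + 1 := (le_max_left _ _).trans_lt (lt_add_one _)
    refine exists_le_of_tendsto_ultrafilter u (F := fun F x => F (x, y)) x₀
      (C := ρ (max (f (x₀, y)) R + 1)) (fun x => hlim _)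
      (hS'.mono fun F hF x x' => by simpa using hF.le_add_dist x x' y y) ?_
    filter_upwards [hS', (hlim (x₀, y)).eventually (eventually_lt_nhds hs)] with F hF hlt
    obtain ⟨x, hx⟩ := hF.exists_fst y
    exact ⟨x, hF.dist_fst_le _ _ _ _
      (hx.trans_lt ((le_max_right _ _).trans_lt (lt_add_one _))) hlt, hx⟩
  · rcases isEmpty_or_nonempty H with _ | ⟨⟨y₀⟩⟩
    · obtain ⟨F, hF⟩ := hS'.exists
      exact isEmptyElim (hF.exists_snd x).choose
    have hs : f (x, y₀) < max (f (x, y₀)) R + 1 := (le_max_left _ _).trans_lt (lt_add_one _)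
    refine exists_le_of_tendsto_ultrafilter u (F := fun F y => F (x, y)) y₀
      (C := ρ (max (f (x, y₀)) R + 1)) (fun y => hlim _)
      (hS'.mono fun F hF y y' => by simpa using hF.le_add_dist x x y y') ?_
    filter_upwards [hS', (hlim (x, y₀)).eventually (eventually_lt_nhds hs)] with F hF hlt
    obtain ⟨y, hy⟩ := hF.exists_snd x
    exact ⟨y, hF.dist_snd_le _ _ _ _
      (hy.trans_lt ((le_max_right _ _).trans_lt (lt_add_one _))) hlt, hy⟩

/-- The distance to the graph of a coarse equivalence. -/
theorem IsCoarseEquivalence.exists_isCoarseGraph {G H : Type*} [mG : MetricSpace G]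
    [mH : MetricSpace H] [Nonempty G] {φ : G → H} (hφ : IsCoarseEquivalence mG mH φ) :
    ∃ (ρ : ℝ → ℝ) (R : ℝ) (f : G × H → ℝ), IsCoarseGraph ρ R f := by
  choose a ha using hφ.exists_dist_map_le
  choose b hb using hφ.exists_dist_le
  obtain ⟨R, hR⟩ := hφ.cobounded
  have bdd : ∀ p : G × H, BddBelow (Set.range fun z => dist p.1 z + dist p.2 (φ z)) := fun p =>
    ⟨0, by rintro _ ⟨z, rfl⟩; positivity⟩
  have exists_lt : ∀ {x : G} {y : H} {s : ℝ}, ⨅ z, dist x z + dist y (φ z) < s →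
      ∃ z, dist x z ≤ s ∧ dist y (φ z) ≤ s := fun {x y s} h => by
    obtain ⟨z, hz⟩ := exists_lt_of_ciInf_lt h
    have := dist_nonneg (x := x) (y := z)
    have := dist_nonneg (x := y) (y := φ z)
    exact ⟨z, by linarith, by linarith⟩
  -- Two points in a sublevel fibre are each within s of graph points, which costs 2 * s. The two
  -- graph points are within 2 * s in one coordinate, so a or b controls the other.
  refine ⟨fun s => 2 * s + max (a (2 * s)) (b (2 * s)), max R 0,
    fun p => ⨅ z, dist p.1 z + dist p.2 (φ z), fun p => le_ciInf fun z => by positivity,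
    fun x x' y y' => ?_, fun s x x' y h h' => ?_, fun s x y y' h h' => ?_, fun y => ?_,
    fun x => ?_⟩
  · rw [add_assoc, ← sub_le_iff_le_add]
    refine le_ciInf fun z => ?_
    rw [sub_le_iff_le_add]
    refine (ciInf_le (bdd (x, y)) z).trans ?_
    dsimp only
    linarith [dist_triangle x x' z, dist_triangle y y' (φ z)]
  · obtain ⟨z, hxz, hyz⟩ := exists_lt h
    obtain ⟨z', hxz', hyz'⟩ := exists_lt h'
    have h1 : dist (φ z) (φ z') ≤ 2 * s := by
      linarith [dist_triangle_left (φ z) (φ z') y]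
    have h2 := (hb _ _ _ h1).trans (le_max_right (a (2 * s)) _)
    linarith [dist_triangle4 x z z' x', dist_comm z' x']
  · obtain ⟨z, hxz, hyz⟩ := exists_lt h
    obtain ⟨z', hxz', hyz'⟩ := exists_lt h'
    have h1 : dist z z' ≤ 2 * s := by linarith [dist_triangle_left z z' x]
    have h2 := (ha _ _ _ h1).trans (le_max_left _ (b (2 * s)))
    linarith [dist_triangle4 y (φ z) (φ z') y', dist_comm (φ z') y']
  · obtain ⟨x, hx⟩ := hR y
    exact ⟨x, (ciInf_le (bdd (x, y)) x).trans (by simpa using Or.inl hx)⟩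
  · exact ⟨φ x, (ciInf_le (bdd (x, φ x)) x).trans (by simp)⟩

/-- The space of coarse graphs, with the topology of pointwise convergence. -/
def CoarseGraph (G H : Type*) [MetricSpace G] [MetricSpace H] (ρ : ℝ → ℝ) (R : ℝ) : Type _ :=
  {f : G × H → ℝ // IsCoarseGraph ρ R f}

namespace CoarseGraph

section Topology

variable {G H : Type*} [MetricSpace G] [MetricSpace H] {ρ : ℝ → ℝ} {R : ℝ}

instance : TopologicalSpace (CoarseGraph G H ρ R) :=
  inferInstanceAs (TopologicalSpace {f : G × H → ℝ // IsCoarseGraph ρ R f})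

instance : CoeFun (CoarseGraph G H ρ R) fun _ => G × H → ℝ := ⟨Subtype.val⟩

@[ext]
theorem ext {f f' : CoarseGraph G H ρ R} (h : ∀ p, f p = f' p) : f = f' :=
  Subtype.ext (funext h)

theorem continuous_eval (p : G × H) : Continuous fun f : CoarseGraph G H ρ R => f p :=
  (continuous_apply p).comp continuous_subtype_val

theorem continuous_iff {T : Type*} [TopologicalSpace T] {F : T → CoarseGraph G H ρ R} :
    Continuous F ↔ ∀ p, Continuous fun t => F t p :=
  continuous_induced_rng.trans continuous_pi_iff

theorem abs_sub_le (f : CoarseGraph G H ρ R) (p q : G × H) :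
    |f p - f q| ≤ dist p.1 q.1 + dist p.2 q.2 := by
  have h₁ := f.2.le_add_dist p.1 q.1 p.2 q.2
  have h₂ := f.2.le_add_dist q.1 p.1 q.2 p.2
  rw [dist_comm q.1, dist_comm q.2] at h₂
  exact abs_sub_le_iff.2 ⟨by linarith, by linarith⟩

/-- Joint continuity of the evaluation map. -/
theorem continuous_uncurry_eval :
    Continuous fun t : CoarseGraph G H ρ R × (G × H) => t.1 t.2 := by
  refine continuous_iff_continuousAt.2 fun ⟨f, p⟩ => ?_
  -- The Lipschitz bound is uniform in the function, so moving the evaluation point is harmless.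
  have h₁ : Tendsto (fun t : CoarseGraph G H ρ R × (G × H) => t.1 t.2 - t.1 p)
      (𝓝 (f, p)) (𝓝 0) := by
    refine squeeze_zero_norm (fun t => t.1.abs_sub_le t.2 p) ?_
    have : Continuous fun t : CoarseGraph G H ρ R × (G × H) =>
        dist t.2.1 p.1 + dist t.2.2 p.2 := by fun_prop
    simpa using this.tendsto (f, p)
  have h₂ : Tendsto (fun t : CoarseGraph G H ρ R × (G × H) => t.1 p) (𝓝 (f, p)) (𝓝 (f p)) :=
    ((continuous_eval p).comp continuous_fst).tendsto (f, p)
  simpa [ContinuousAt] using h₁.add h₂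

instance : T2Space (CoarseGraph G H ρ R) :=
  inferInstanceAs (T2Space {f : G × H → ℝ // IsCoarseGraph ρ R f})

/-- One bounded value bounds all others by the Lipschitz estimate, so the set is closed in a product
of compact intervals. -/
theorem isCompact_setOf_apply_le [ProperSpace G] [ProperSpace H] (p : G × H) (r : ℝ) :
    IsCompact {f : CoarseGraph G H ρ R | f p ≤ r} := by
  have hemb : Topology.IsClosedEmbedding (Subtype.val : CoarseGraph G H ρ R → G × H → ℝ) :=
    (isClosed_setOf_isCoarseGraph ρ R).isClosedEmbedding_subtypeVal
  have hbox : IsCompact (Set.univ.pi fun q : G × H =>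
      Set.Icc 0 (r + dist q.1 p.1 + dist q.2 p.2)) :=
    isCompact_univ_pi fun _ => isCompact_Icc
  refine (hemb.isCompact_preimage hbox).of_isClosed_subset
    (isClosed_le (continuous_eval p) continuous_const) fun f hf q _ => ⟨f.2.nonneg q, ?_⟩
  have hf' : f.1 (p.1, p.2) ≤ r := hf
  exact (f.2.le_add_dist q.1 p.1 q.2 p.2).trans (by linarith)

instance [Nonempty (G × H)] [ProperSpace G] [ProperSpace H] :
    LocallyCompactSpace (CoarseGraph G H ρ R) := by
  obtain ⟨p⟩ := ‹Nonempty (G × H)›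
  have : WeaklyLocallyCompactSpace (CoarseGraph G H ρ R) := ⟨fun f =>
    ⟨_, isCompact_setOf_apply_le p (f p + 1),
      (continuous_eval p).continuousAt.eventually (eventually_le_nhds (lt_add_one _))⟩⟩
  infer_instance

end Topology

variable {G H : Type*} [Group G] [MetricSpace G] [IsIsometricSMul G G]
  [Group H] [MetricSpace H] [IsIsometricSMul H H] {ρ : ℝ → ℝ} {R : ℝ}

theorem isCoarseGraph_translate {f : G × H → ℝ} (hf : IsCoarseGraph ρ R f) (g : G) (h : H) :
    IsCoarseGraph ρ R fun p => f (g * p.1, h * p.2) where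
  nonneg p := hf.nonneg _
  le_add_dist x x' y y' := by
    simpa using hf.le_add_dist (g * x) (g * x') (h * y) (h * y')
  dist_fst_le s x x' y h₁ h₂ := by simpa using hf.dist_fst_le s _ _ _ h₁ h₂
  dist_snd_le s x y y' h₁ h₂ := by simpa using hf.dist_snd_le s _ _ _ h₁ h₂
  exists_fst y := by
    obtain ⟨x, hx⟩ := hf.exists_fst (h * y)
    exact ⟨g⁻¹ * x, by simpa using hx⟩
  exists_snd x := by
    obtain ⟨y, hy⟩ := hf.exists_snd (g * x)
    exact ⟨h⁻¹ * y, by simpa using hy⟩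

instance : MulAction G (CoarseGraph G H ρ R) where
  smul g f := ⟨fun p => f (g⁻¹ * p.1, p.2), by simpa using isCoarseGraph_translate f.2 g⁻¹ 1⟩
  one_smul f := ext fun p => by change f (1⁻¹ * p.1, p.2) = f p; simp
  mul_smul g g' f := ext fun p => by
    change f ((g * g')⁻¹ * p.1, p.2) = f (g'⁻¹ * (g⁻¹ * p.1), p.2); simp [mul_assoc]

instance : MulAction Hᵐᵒᵖ (CoarseGraph G H ρ R) where
  smul h f := ⟨fun p => f (p.1, h.unop * p.2), by simpa using isCoarseGraph_translate f.2 1 h.unop⟩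
  one_smul f := ext fun p => by change f (p.1, 1 * p.2) = f p; simp
  mul_smul h h' f := ext fun p => by
    change f (p.1, (h'.unop * h.unop) * p.2) = f (p.1, h'.unop * (h.unop * p.2))
    rw [mul_assoc]

theorem smul_apply (g : G) (f : CoarseGraph G H ρ R) (p : G × H) :
    (g • f) p = f (g⁻¹ * p.1, p.2) := rfl

theorem op_smul_apply (h : H) (f : CoarseGraph G H ρ R) (p : G × H) :
    (op h • f) p = f (p.1, h * p.2) := rfl

end CoarseGraph

/-- Projection along the compact factor K is a closed map. This upgrades containment of return sets
in a compact set to compactness. -/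
theorem isClosed_setOf_image_inter_nonempty {T X : Type*} [TopologicalSpace T]
    [TopologicalSpace X] [T2Space X] {a : T → X → X} (ha : Continuous fun p : T × X => a p.1 p.2)
    {K : Set X} (hK : IsCompact K) : IsClosed {t | (a t '' K ∩ K).Nonempty} := by
  have : CompactSpace K := isCompact_iff_compactSpace.1 hK
  have hcl : IsClosed {p : T × K | a p.1 p.2 ∈ K} :=
    hK.isClosed.preimage (ha.comp (continuous_fst.prodMk (continuous_subtype_val.comp
      continuous_snd)))
  convert isClosedMap_fst_of_compactSpace _ hcl
  ext t
  constructor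
  · rintro ⟨_, ⟨x, hx, rfl⟩, hxK⟩
    exact ⟨(t, ⟨x, hx⟩), hxK, rfl⟩
  · rintro ⟨⟨t', x⟩, hx, rfl⟩
    exact ⟨_, ⟨x, x.2, rfl⟩, hx⟩

theorem CoarseGraph.isTopologicalCoupling {G H : Type*}
    [Group G] [MetricSpace G] [IsIsometricSMul G G] [ProperSpace G] [IsTopologicalGroup G]
    [Group H] [MetricSpace H] [IsIsometricSMul H H] [ProperSpace H] [IsTopologicalGroup H]
    {ρ : ℝ → ℝ} {R : ℝ} (hne : Nonempty (CoarseGraph G H ρ R)) :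
    IsTopologicalCoupling G H (CoarseGraph G H ρ R) := by
  have cl : Continuous fun p : G × CoarseGraph G H ρ R => p.1 • p.2 :=
    CoarseGraph.continuous_iff.2 fun p => CoarseGraph.continuous_uncurry_eval.comp
      (f := fun t : G × CoarseGraph G H ρ R => (t.2, (t.1⁻¹ * p.1, p.2))) (by fun_prop)
  have cr : Continuous fun p : CoarseGraph G H ρ R × H => op p.2 • p.1 :=
    CoarseGraph.continuous_iff.2 fun p => CoarseGraph.continuous_uncurry_eval.comp
      (f := fun t : CoarseGraph G H ρ R × H => (t.1, (p.1, t.2 * p.2))) (by fun_prop)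
  have bdd : ∀ K : Set (CoarseGraph G H ρ R), IsCompact K → ∃ s, ∀ f ∈ K, f (1, 1) < s := by
    intro K hK
    obtain ⟨s, hs⟩ := (hK.image (CoarseGraph.continuous_eval (1, 1))).bddAbove
    exact ⟨s + 1, fun f hf => (hs ⟨f, hf, rfl⟩).trans_lt (lt_add_one _)⟩
  refine ⟨hne, inferInstance, inferInstance, fun g h f => rfl, cl, cr, fun K hK => ?_,
    fun K hK => ?_, {f | f (1, 1) ≤ R}, CoarseGraph.isCompact_setOf_apply_le _ _, ?_, ?_⟩
  -- Both f (g⁻¹, 1) and f (1, 1) are below s, so g⁻¹ lies in the ball of radius ρ s; hence the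
  -- inverse of that ball.
  · obtain ⟨s, hs⟩ := bdd K hK
    refine (isCompact_closedBall (1 : G) (ρ s)).inv.of_isClosed_subset
      (isClosed_setOf_image_inter_nonempty cl hK) ?_
    rintro g ⟨_, ⟨f, hf, rfl⟩, hgf⟩
    have := hs _ hgf
    simp only [CoarseGraph.smul_apply, mul_one] at this
    exact f.2.dist_fst_le s _ _ _ this (hs f hf)
  · obtain ⟨s, hs⟩ := bdd K hK
    refine (isCompact_closedBall (1 : H) (ρ s)).of_isClosed_subset
      (isClosed_setOf_image_inter_nonempty (cr.comp continuous_swap) hK) ?_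
    rintro h ⟨_, ⟨f, hf, rfl⟩, hhf⟩
    have := hs _ hhf
    simp only [CoarseGraph.op_smul_apply, mul_one] at this
    exact f.2.dist_snd_le s _ _ _ this (hs f hf)
  · refine Set.eq_univ_of_forall fun f => ?_
    obtain ⟨x, hx⟩ := f.2.exists_fst 1
    refine Set.mem_iUnion.2 ⟨x, Set.mem_smul_set_iff_inv_smul_mem.2 ?_⟩
    simpa [CoarseGraph.smul_apply] using hx
  · refine Set.eq_univ_of_forall fun f => ?_
    obtain ⟨y, hy⟩ := f.2.exists_snd 1
    refine Set.mem_iUnion.2 ⟨y⁻¹, Set.mem_smul_set_iff_inv_smul_mem.2 ?_⟩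
    rw [← op_inv, inv_inv]
    simpa [CoarseGraph.op_smul_apply] using hy

/-! ### Transport of couplings to larger universes -/

theorem smul_inter_nonempty_iff_image_down {Z X : Type*} [Group Z] [MulAction Z X] (z : Z)
    (K : Set (ULift.{w} X)) :
    (z • K ∩ K).Nonempty ↔ (z • (ULift.down '' K) ∩ ULift.down '' K).Nonempty := by
  constructor
  · rintro ⟨_, ⟨x, hx, rfl⟩, hxK⟩
    exact ⟨z • x.down, ⟨x.down, ⟨x, hx, rfl⟩, rfl⟩, ⟨_, hxK, rfl⟩⟩
  · rintro ⟨_, ⟨_, ⟨x, hx, rfl⟩, rfl⟩, ⟨y, hy, hxy⟩⟩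
    exact ⟨z • x, ⟨x, hx, rfl⟩, (ULift.ext _ _ hxy : y = z • x) ▸ hy⟩

theorem IsTopologicalCoupling.ulift {G H X : Type*} [Group G] [TopologicalSpace G] [Group H]
    [TopologicalSpace H] [TopologicalSpace X] [MulAction G X] [MulAction Hᵐᵒᵖ X]
    (hX : IsTopologicalCoupling G H X) : IsTopologicalCoupling G H (ULift.{w} X) := by
  have := hX.t2Space
  have := hX.locallyCompactSpace
  obtain ⟨K, hK, hGK, hHK⟩ := hX.cocompact
  refine ⟨hX.nonempty.map ULift.up, inferInstance,
    (Homeomorph.ulift (X := X)).isClosedEmbedding.locallyCompactSpace,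
    fun g h x => congrArg ULift.up (hX.commute g h x.down),
    continuous_uliftUp.comp (hX.continuous_left.comp
      (continuous_fst.prodMk (continuous_uliftDown.comp continuous_snd))),
    continuous_uliftUp.comp (hX.continuous_right.comp
      ((continuous_uliftDown.comp continuous_fst).prodMk continuous_snd)),
    fun L hL => ?_, fun L hL => ?_, ULift.up '' K, hK.image continuous_uliftUp, ?_, ?_⟩
  · simp only [smul_inter_nonempty_iff_image_down]
    exact hX.proper_left _ (hL.image continuous_uliftDown)
  · simp only [smul_inter_nonempty_iff_image_down]
    exact hX.proper_right _ (hL.image continuous_uliftDown)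
  · refine Set.eq_univ_of_forall fun x => ?_
    obtain ⟨g, y, hy, hyx⟩ := Set.mem_iUnion.1 (hGK.symm ▸ Set.mem_univ x.down)
    exact Set.mem_iUnion.2 ⟨g, ULift.up y, ⟨y, hy, rfl⟩, ULift.ext _ _ hyx⟩
  · refine Set.eq_univ_of_forall fun x => ?_
    obtain ⟨g, y, hy, hyx⟩ := Set.mem_iUnion.1 (hHK.symm ▸ Set.mem_univ x.down)
    exact Set.mem_iUnion.2 ⟨g, ULift.up y, ⟨y, hy, rfl⟩, ULift.ext _ _ hyx⟩

/-! ### The main theorem -/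

theorem IsCompatibleProperLeftInvariant.isIsometricSMul {G : Type*} [Group G]
    [m : MetricSpace G] (hm : IsCompatibleProperLeftInvariant m) : IsIsometricSMul G G :=
  ⟨fun g => Isometry.of_dist_eq (hm.left_invariant g)⟩

theorem IsCompatibleProperLeftInvariant.properSpace {G : Type*} [Group G]
    [m : MetricSpace G] (hm : IsCompatibleProperLeftInvariant m) : ProperSpace G :=
  ⟨hm.proper⟩

theorem exists_isCoarseEquivalence_iff_admitTopologicalCoupling (G : Type u) (H : Type v)
    [Group G] [tG : TopologicalSpace G] [IsTopologicalGroup G]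
    [Group H] [tH : TopologicalSpace H] [IsTopologicalGroup H]
    {dG : MetricSpace G} {dH : MetricSpace H}
    (hG : IsCompatibleProperLeftInvariant dG) (hH : IsCompatibleProperLeftInvariant dH) :
    (∃ φ : G → H, IsCoarseEquivalence dG dH φ) ↔ AdmitTopologicalCoupling.{u, v, w} G H := by
  -- Replacing the given topologies by the metric ones lets the results stated for metric groups
  -- apply.
  obtain rfl := hG.compatible
  obtain rfl := hH.compatible
  have := hG.isIsometricSMul
  have := hH.isIsometricSMul
  have := hG.properSpace
  have := hH.properSpace
  constructor
  · rintro ⟨φ, hφ⟩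
    obtain ⟨ρ, R, f, hf⟩ := hφ.exists_isCoarseGraph
    exact ⟨ULift.{w} (CoarseGraph G H ρ R), _, _, _,
      (CoarseGraph.isTopologicalCoupling ⟨⟨f, hf⟩⟩).ulift⟩
  · rintro ⟨X, _, _, _, hX⟩
    exact hX.exists_isCoarseEquivalence

theorem theorem1 (G : Type u) (H : Type v)
    [Group G] [TopologicalSpace G] [IsTopologicalGroup G] [T2Space G]
    [LocallyCompactSpace G] [SecondCountableTopology G]
    [Group H] [TopologicalSpace H] [IsTopologicalGroup H] [T2Space H]
    [LocallyCompactSpace H] [SecondCountableTopology H] :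
    (CoarselyEquivalent G H ↔ AdmitTopologicalCoupling.{u, v, w} G H) ∧
      ∀ (dG : MetricSpace G) (dH : MetricSpace H),
        IsCompatibleProperLeftInvariant dG → IsCompatibleProperLeftInvariant dH →
          ((∃ φ : G → H, IsCoarseEquivalence dG dH φ) ↔
            AdmitTopologicalCoupling.{u, v, w} G H) := by
  refine ⟨⟨?_, fun h => ?_⟩, fun dG dH hG hH =>
    exists_isCoarseEquivalence_iff_admitTopologicalCoupling G H hG hH⟩
  · rintro ⟨dG, dH, hG, hH, h⟩
    exact (exists_isCoarseEquivalence_iff_admitTopologicalCoupling G H hG hH).1 h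
  · obtain ⟨dG, hG⟩ := exists_isCompatibleProperLeftInvariant G
    obtain ⟨dH, hH⟩ := exists_isCompatibleProperLeftInvariant H
    exact ⟨dG, dH, hG, hH,
      (exists_isCoarseEquivalence_iff_admitTopologicalCoupling G H hG hH).2 h⟩
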